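/- Let $\mathbb K=\mathbb R$ or $\mathbb C$, let $X$ and $Y$ be Banach spaces over $\mathbb K$, let $k\ge 1$ be an integer, and let $P\colon X\to Y$ be a continuous $k$-homogeneous polynomial, that is, $P(x)=M(x,\dots,x)$ for some continuous $k$-linear map $M\colon X^k\to Y$. A series $\sum x_n$ in $X$ is *weakly unconditionally Cauchy* (w.u.C.) if $\sum_n|\varphi(x_n)|<\infty$ for every $\varphi\in X^*$, and *unconditionally convergent* (u.c.) if every subseries converges in norm. The polynomial $P$ is *unconditionally converging* if, for each w.u.C. series $\sum x_n$ in $X$, the sequence $\bigl(P(\sum_{i=1}^n x_i)\bigr)_n$ converges in norm in $Y$. It is an *Orlicz-Pettis polynomial* if every w.u.C. series $\sum x_n$ in $X$ with the following property is u.c.: for every bounded sequence $(a_n)\subset c_0$, the set $\{P(\sum_{i=1}^\infty a_n(i)x_i): n\in\mathbb N\}$ is relatively weakly compact in $Y$. A set $A\subset X$ is a *WUC-set* if $A=T(B_{c_0})$ for some bounded linear operator $T\colon c_0\to X$, where $B_{c_0}$ is the closed unit ball of $c_0$ (over $\mathbb K$). Then: (a) The following are equivalent: (a1) $P$ is unconditionally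 converging; (a2) $P(A)$ is relatively compact in $Y$ for every WUC-set $A\subset X$; (a3) $P(A)$ is relatively weakly compact in $Y$ for every WUC-set $A\subset X$. (b) The following are equivalent: (b1) $P$ is an Orlicz-Pettis polynomial; (b2) for every WUC-set $A\subset X$, if $P(A)$ is relatively compact in $Y$, then $A$ is relatively compact in $X$; (b3) for every WUC-set $A\subset X$, if $P(A)$ is relatively weakly compact in $Y$, then $A$ is relatively weakly compact in $X$. -/

import Mathlib

open scoped ZeroAtInfty

namespace OrliczPettis

variable (𝕜 : Type*) [RCLike 𝕜]
variable {X : Type*} [NormedAddCommGroup X] [NormedSpace 𝕜 X]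
variable {Y : Type*} [NormedAddCommGroup Y] [NormedSpace 𝕜 Y]

/-- `P` is a continuous `k`-homogeneous polynomial from `X` into `Y`: it is the restriction to the
diagonal of a continuous `k`-linear map `X × ⋯ × X → Y`. -/
def IsHomogeneousPolynomial (k : ℕ) (P : X → Y) : Prop :=
  ∃ M : ContinuousMultilinearMap 𝕜 (fun _ : Fin k => X) Y, ∀ x : X, P x = M (fun _ => x)

/-- The formal series `∑ xₙ` is weakly unconditionally Cauchy:
`∑ |φ(xₙ)| < ∞` for every continuous linear functional `φ`. -/
def IsWUC (x : ℕ → X) : Prop :=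
  ∀ φ : StrongDual 𝕜 X, Summable (fun n => ‖φ (x n)‖)

/-- The series `∑ xₙ` is unconditionally convergent: every subseries converges
(in norm, as a sequence of partial sums). -/
def IsUC {X : Type*} [NormedAddCommGroup X] (x : ℕ → X) : Prop :=
  ∀ σ : ℕ → ℕ, StrictMono σ →
    ∃ s : X, Filter.Tendsto (fun n => ∑ i ∈ Finset.range n, x (σ i)) Filter.atTop (nhds s)

/-- `A` is relatively compact for the norm topology. -/
def IsRelCompact {X : Type*} [NormedAddCommGroup X] (A : Set X) : Prop :=
  IsCompact (closure A)

/-- `A` is relatively weakly compact: its closure in the weak topology is weakly compact. -/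
def IsRelWeaklyCompact (A : Set X) : Prop :=
  IsCompact (closure (toWeakSpace 𝕜 X '' A))

/-- `P` is unconditionally converging: for each weakly unconditionally Cauchy series `∑ xₙ`,
the sequence `P(x₁ + ⋯ + xₙ)` converges in norm. -/
def IsUnconditionallyConverging (P : X → Y) : Prop :=
  ∀ x : ℕ → X, IsWUC 𝕜 x →
    ∃ y : Y, Filter.Tendsto (fun n => P (∑ i ∈ Finset.range n, x i)) Filter.atTop (nhds y)

/-- `P` has the Orlicz-Pettis property: a weakly unconditionally Cauchy series `∑ xₙ` is
unconditionally convergent as soon as, for every bounded sequence `(aₙ)` in `c₀`, the set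
`{P(∑ᵢ aₙ(i) xᵢ) : n ∈ ℕ}` is relatively weakly compact. Here `C₀(ℕ, 𝕜)` is `c₀` with the sup norm.
In a Banach space the inner series converge (unconditionally), since `∑ xᵢ` is weakly
unconditionally Cauchy and the coefficients tend to zero. -/
def IsOrliczPettis (P : X → Y) : Prop :=
  ∀ x : ℕ → X, IsWUC 𝕜 x →
    (∀ a : ℕ → C₀(ℕ, 𝕜), Bornology.IsBounded (Set.range a) →
      IsRelWeaklyCompact 𝕜 (Set.range fun n => P (∑' i, a n i • x i))) →
    IsUC x

/-- `A` is a WUC-set: the image of the closed unit ball of `c₀` under a bounded linear operator. -/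
def IsWUCSet (A : Set X) : Prop :=
  ∃ T : C₀(ℕ, 𝕜) →L[𝕜] X, A = T '' Metric.closedBall 0 1

end OrliczPettis

open scoped ZeroAtInfty
namespace OrliczPettis
open Filter Topology TopologicalSpace BoundedContinuousFunction

/-! A w.u.C. series in `X` is the image of the unit vectors under a bounded operator T from c₀ to
`X` (`IsWUC.exists_operator`), so everything concerns the polynomials P ∘ T on c₀. The pivot is
`CoordCont`. Balls of c₀ are precompact for coordinatewise convergence, so `CoordCont` makes the
image of a ball relatively compact (`CoordCont.isRelCompact`) and makes P ∘ T converge along partial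
sums.

Conversely, each hypothesis forces `CoordCont`. Convergence along w.u.C. series does so by a gliding
hump (`coordCont_of_cauchySeq`). Relative weak compactness lets P ∘ T extend to ℓ^∞ by weak limits
along truncations, and a Baire category argument upgrades weak to norm continuity of the extension
(`WeakCoordCont.normCoordCont`). In both arguments differences lower the degree, so induction
carries continuity at one point to all points.

Hence each condition in (a) says that P ∘ T is `CoordCont` for every T. Each condition in (b) says
that T is `CoordCont` whenever P ∘ T is, because T is itself a polynomial of degree one and meets
the same criteria. -/

/-- `f` is annihilated by all differences of order `n + 1`. -/
def DegLE {E F : Type*} [Add E] [Sub F] : ℕ → (E → F) → Prop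
  | 0, f => ∀ x y, f x = f y
  | n + 1, f => ∀ h, DegLE n (fun x => f (x + h) - f x)

/-! ### Coordinates and truncations in c₀ -/

theorem c0_norm_le {𝕜 : Type*} [RCLike 𝕜] {a : C₀(ℕ, 𝕜)} {R : ℝ} (hR : 0 ≤ R) :
    ‖a‖ ≤ R ↔ ∀ i, ‖a i‖ ≤ R := by
  rw [← ZeroAtInftyContinuousMap.norm_toBCF_eq_norm, BoundedContinuousFunction.norm_le hR]
  rfl

theorem c0_norm_apply_le {𝕜 : Type*} [RCLike 𝕜] (a : C₀(ℕ, 𝕜)) (i : ℕ) : ‖a i‖ ≤ ‖a‖ :=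
  (c0_norm_le (norm_nonneg _)).1 le_rfl i

theorem c0_tendsto {𝕜 : Type*} [RCLike 𝕜] (a : C₀(ℕ, 𝕜)) : Tendsto a atTop (𝓝 0) := by
  have := a.zero_at_infty'
  rwa [Filter.cocompact_eq_cofinite, Nat.cofinite_eq_atTop] at this

/-- The element of `c₀` that agrees with `b` on the first `n` coordinates and vanishes beyond. -/
def trunc {𝕜 : Type*} [RCLike 𝕜] (n : ℕ) (b : ℕ → 𝕜) : C₀(ℕ, 𝕜) where
  toFun i := if i < n then b i else 0
  continuous_toFun := continuous_of_discreteTopology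
  zero_at_infty' := by
    rw [Filter.cocompact_eq_cofinite, Nat.cofinite_eq_atTop]
    refine tendsto_const_nhds.congr' ?_
    filter_upwards [eventually_ge_atTop n] with i hi
    simp [not_lt.2 hi]

theorem trunc_apply {𝕜 : Type*} [RCLike 𝕜] (n : ℕ) (b : ℕ → 𝕜) (i : ℕ) :
    trunc n b i = if i < n then b i else 0 := rfl

theorem norm_trunc_le {𝕜 : Type*} [RCLike 𝕜] {n : ℕ} {b : ℕ → 𝕜} {R : ℝ} (hR : 0 ≤ R)
    (hb : ∀ i, ‖b i‖ ≤ R) : ‖trunc n b‖ ≤ R := by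
  rw [c0_norm_le hR]
  intro i
  rw [trunc_apply]
  split_ifs
  · exact hb i
  · simpa using hR

theorem tendsto_trunc_apply {𝕜 : Type*} [RCLike 𝕜] (b : ℕ → 𝕜) (i : ℕ) :
    Tendsto (fun n => trunc n b i) atTop (𝓝 (b i)) := by
  refine tendsto_const_nhds.congr' ?_
  filter_upwards [eventually_gt_atTop i] with n hn
  simp [trunc_apply, hn]

/-- `g` is uniformly continuous for coordinatewise convergence on bounded subsets of `c₀`. -/
def CoordCont {𝕜 : Type*} [RCLike 𝕜] {Y : Type*} [NormedAddCommGroup Y]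
    (g : C₀(ℕ, 𝕜) → Y) : Prop :=
  ∀ (l : Filter (C₀(ℕ, 𝕜) × C₀(ℕ, 𝕜))) (R : ℝ) (b : ℕ → 𝕜),
    (∀ᶠ p in l, ‖p.1‖ ≤ R ∧ ‖p.2‖ ≤ R) →
    (∀ i, Tendsto (fun p => p.1 i) l (𝓝 (b i))) →
    (∀ i, Tendsto (fun p => p.2 i) l (𝓝 (b i))) →
    Tendsto (fun p => g p.1 - g p.2) l (𝓝 0)

/-! ### Reduction to continuity at the origin, and the scalar case -/

section
variable {𝕜 : Type*} [RCLike 𝕜] {Y : Type*} [NormedAddCommGroup Y]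

theorem CoordCont.tendsto_sub {g : C₀(ℕ, 𝕜) → Y} (hg : CoordCont g) {ι : Type*} {l : Filter ι}
    {x y : ι → C₀(ℕ, 𝕜)} {R : ℝ} {b : ℕ → 𝕜}
    (hxR : ∀ᶠ p in l, ‖x p‖ ≤ R) (hyR : ∀ᶠ p in l, ‖y p‖ ≤ R)
    (hx : ∀ i, Tendsto (fun p => x p i) l (𝓝 (b i)))
    (hy : ∀ i, Tendsto (fun p => y p i) l (𝓝 (b i))) :
    Tendsto (fun p => g (x p) - g (y p)) l (𝓝 0) := by
  have := hg (l.map fun p => (x p, y p)) R b (by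
    rw [eventually_map]; exact hxR.and hyR) (fun i => tendsto_map'_iff.2 (hx i))
      (fun i => tendsto_map'_iff.2 (hy i))
  exact tendsto_map'_iff.1 this

/-- Translation by a fixed vector changes `g p.1 - g p.2` by a difference of first-order increments,
which tends to 0 by `hΔ`; half of the gap `ε` survives. Subtracting the truncation of `b` brings
both points close to 0 in the first `k` coordinates. -/
theorem exists_seq_of_not_tendsto_sub {k : ℕ} {g : C₀(ℕ, 𝕜) → Y}
    (hΔ : ∀ h, CoordCont fun x => g (x + h) - g x)
    {l : Filter (C₀(ℕ, 𝕜) × C₀(ℕ, 𝕜))} {R : ℝ} {b : ℕ → 𝕜}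
    (hR : ∀ᶠ p in l, ‖p.1‖ ≤ R ∧ ‖p.2‖ ≤ R)
    (h1 : ∀ i, Tendsto (fun p => p.1 i) l (𝓝 (b i)))
    (h2 : ∀ i, Tendsto (fun p => p.2 i) l (𝓝 (b i)))
    {ε : ℝ} (hε : 0 < ε) (hfr : ∃ᶠ p in l, ε ≤ ‖g p.1 - g p.2‖) :
    ∃ p : C₀(ℕ, 𝕜) × C₀(ℕ, 𝕜), (‖p.1‖ ≤ R ∧ ‖p.2‖ ≤ R) ∧
      (∀ i ∈ Finset.range k, ‖p.1 i - b i‖ < 1 / ((k : ℝ) + 1) ∧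
        ‖p.2 i - b i‖ < 1 / ((k : ℝ) + 1)) ∧
      ε / 2 ≤ ‖g (p.1 - trunc k b) - g (p.2 - trunc k b)‖ := by
  have hk : (0 : ℝ) < 1 / ((k : ℝ) + 1) := by positivity
  have e1 : ∀ᶠ p in l, ∀ i ∈ Finset.range k, ‖p.1 i - b i‖ < 1 / ((k : ℝ) + 1) ∧
        ‖p.2 i - b i‖ < 1 / ((k : ℝ) + 1) := by
    rw [Finset.eventually_all]
    intro i _
    have a1 := (Metric.tendsto_nhds.1 (h1 i)) _ hk
    have a2 := (Metric.tendsto_nhds.1 (h2 i)) _ hk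
    simp only [dist_eq_norm] at a1 a2
    exact a1.and a2
  have e2 := hΔ (-trunc k b) l R b hR h1 h2
  have e3 := (Metric.tendsto_nhds.1 e2) _ (half_pos hε)
  obtain ⟨p, hp, hp1, hp2, hp3⟩ := (hfr.and_eventually (hR.and (e1.and e3))).exists
  refine ⟨p, hp1, hp2, ?_⟩
  simp only [dist_zero_right, ← sub_eq_add_neg] at hp3
  have : g p.1 - g p.2 = (g (p.1 - trunc k b) - g (p.2 - trunc k b)) -
    (g (p.1 - trunc k b) - g p.1 - (g (p.2 - trunc k b) - g p.2)) := by abel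
  rw [this] at hp
  have := norm_sub_le (g (p.1 - trunc k b) - g (p.2 - trunc k b))
    (g (p.1 - trunc k b) - g p.1 - (g (p.2 - trunc k b) - g p.2))
  linarith

/-- Uniform coordinatewise continuity of functions of finite degree follows from coordinatewise
continuity at the origin. -/
theorem coordCont_of_degLE (C : Set (C₀(ℕ, 𝕜) → Y))
    (hC : ∀ g ∈ C, ∀ h, (fun x => g (x + h) - g x) ∈ C)
    (h0 : ∀ g ∈ C, (∀ h, CoordCont fun x => g (x + h) - g x) →
      ∀ (l : Filter C₀(ℕ, 𝕜)) (R : ℝ), (∀ᶠ w in l, ‖w‖ ≤ R) →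
        (∀ i, Tendsto (fun w : C₀(ℕ, 𝕜) => w i) l (𝓝 0)) → Tendsto g l (𝓝 (g 0))) :
    ∀ (k : ℕ) (g : C₀(ℕ, 𝕜) → Y), DegLE k g → g ∈ C → CoordCont g := by
  intro k
  induction k with
  | zero =>
    intro g hg _ l R b _ _ _
    have : (fun p : C₀(ℕ, 𝕜) × C₀(ℕ, 𝕜) => g p.1 - g p.2) = fun _ => 0 := by
      funext p
      rw [hg p.1 p.2, sub_self]
    rw [this]
    exact tendsto_const_nhds
  | succ k ih =>
    intro g hg hgC
    have hΔ : ∀ h, CoordCont fun x => g (x + h) - g x := fun h => ih _ (hg h) (hC g hgC h)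
    intro l R b hR h1 h2
    by_contra hcon
    rw [Metric.tendsto_nhds] at hcon
    push Not at hcon
    obtain ⟨ε, hε, hfr⟩ := hcon
    simp only [dist_zero_right] at hfr
    choose p hpR hpb hpg using fun k : ℕ =>
      exists_seq_of_not_tendsto_sub (k := k) hΔ hR h1 h2 hε hfr
    have hl : l.NeBot := by
      by_contra hb
      rw [not_neBot] at hb
      subst hb
      simp at hfr
    have hR0 : 0 ≤ R := (norm_nonneg _).trans (hpR 0).1
    have hbR : ∀ i, ‖b i‖ ≤ R := fun i => by
      refine le_of_tendsto (h1 i).norm ?_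
      filter_upwards [hR] with p hp
      exact (c0_norm_apply_le _ _).trans hp.1
    -- The limit `b` need not lie in c₀, hence the growing truncations: the differences stay in a
    -- ball of radius `R + R` and tend to 0 coordinatewise, so continuity at the origin applies to
    -- both sequences and closes the gap `ε / 2`.
    have key : ∀ x : ℕ → C₀(ℕ, 𝕜), (∀ n, ‖x n‖ ≤ R) →
        (∀ n, ∀ i ∈ Finset.range n, ‖x n i - b i‖ < 1 / ((n : ℝ) + 1)) →
        Tendsto (fun n => g (x n - trunc n b)) atTop (𝓝 (g 0)) := by
      intro x hx hxb
      have := h0 g hgC hΔ (atTop.map fun n => x n - trunc n b) (R + R) (by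
          rw [eventually_map]
          exact Eventually.of_forall fun n => (norm_sub_le _ _).trans
            (add_le_add (hx n) (norm_trunc_le hR0 hbR))) (by
          intro i
          rw [tendsto_map'_iff]
          refine squeeze_zero_norm' ?_ tendsto_one_div_add_atTop_nhds_zero_nat
          filter_upwards [eventually_gt_atTop i] with n hn
          have := hxb n i (Finset.mem_range.2 hn)
          simpa [trunc_apply, hn] using this.le)
      rwa [tendsto_map'_iff] at this
    have t1 := key (fun n => (p n).1) (fun n => (hpR n).1) (fun n i hi => (hpb n i hi).1)
    have t2 := key (fun n => (p n).2) (fun n => (hpR n).2) (fun n i hi => (hpb n i hi).2)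
    have t3 := (t1.sub t2).norm
    rw [sub_self, norm_zero] at t3
    have := ge_of_tendsto' t3 hpg
    linarith

/-- The hump step: `G` records the moduli already accumulated in each coordinate. Beyond some `N` it
is below `B - R`, leaving room for any `w` of norm at most `R`; on the finitely many coordinates
before `N`, `w` is small. The strict bound persists, so the step can be repeated. -/
theorem eventually_add_norm_lt {G : ℕ → ℝ} {B R : ℝ} (hG : Tendsto G atTop (𝓝 0))
    (hGB : ∀ i, G i < B) (hRB : R < B) {l : Filter C₀(ℕ, 𝕜)} (hR : ∀ᶠ w in l, ‖w‖ ≤ R)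
    (hw : ∀ i, Tendsto (fun w : C₀(ℕ, 𝕜) => w i) l (𝓝 0)) :
    ∀ᶠ w in l, ∀ i, G i + ‖w i‖ < B := by
  obtain ⟨N, hN⟩ := eventually_atTop.1 (hG.eventually (gt_mem_nhds (sub_pos.2 hRB)))
  have e : ∀ᶠ w in l, ∀ i ∈ Finset.range N, ‖w i‖ < B - G i := by
    rw [Finset.eventually_all]
    intro i _
    have := (hw i).norm
    rw [norm_zero] at this
    exact this.eventually (gt_mem_nhds (sub_pos.2 (hGB i)))
  filter_upwards [e, hR] with w hw1 hw2 i
  by_cases hi : i < N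
  · linarith [hw1 i (Finset.mem_range.2 hi)]
  · linarith [hN i (not_lt.1 hi), c0_norm_apply_le w i]

/-- Increments of `g` along `w` are asymptotically the same at `h` as at the origin, so a jump at 0
reappears at every base point. -/
theorem tendsto_sub_sub {g : C₀(ℕ, 𝕜) → Y} (hΔ : ∀ h, CoordCont fun x => g (x + h) - g x)
    {l : Filter C₀(ℕ, 𝕜)} {R : ℝ} (hR : ∀ᶠ w in l, ‖w‖ ≤ R)
    (hw : ∀ i, Tendsto (fun w : C₀(ℕ, 𝕜) => w i) l (𝓝 0)) (h : C₀(ℕ, 𝕜)) :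
    Tendsto (fun w => (g (w + h) - g w) - (g h - g 0)) l (𝓝 0) := by
  by_cases hl : l = ⊥
  · simp [hl]
  have : l.NeBot := ⟨hl⟩
  have hR0 : 0 ≤ R := by
    obtain ⟨w, hw⟩ := hR.exists
    exact (norm_nonneg _).trans hw
  have := (hΔ h).tendsto_sub (l := l) (x := fun w => w) (y := fun _ => 0) (R := R) (b := 0)
    hR (Eventually.of_forall fun _ => by simpa using hR0) hw (fun i => by simp)
  simpa using this

/-- Scalar functions of finite degree that are bounded on bounded sets. -/
theorem coordCont_scalar {k : ℕ} {g : C₀(ℕ, 𝕜) → 𝕜} (hg : DegLE k g)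
    (hb : ∀ R : ℝ, ∃ M, ∀ x, ‖x‖ ≤ R → ‖g x‖ ≤ M) : CoordCont g := by
  refine coordCont_of_degLE {g | ∀ R : ℝ, ∃ M, ∀ x, ‖x‖ ≤ R → ‖g x‖ ≤ M} ?_ ?_ k g hg hb
  · intro g hg h R
    obtain ⟨M, hM⟩ := hg R
    obtain ⟨M', hM'⟩ := hg (R + ‖h‖)
    exact ⟨M' + M, fun x hx => (norm_sub_le _ _).trans (add_le_add
      (hM' _ ((norm_add_le _ _).trans (by gcongr))) (hM _ hx))⟩
  · clear! g
    intro g hg hΔ l R hR hw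
    by_contra hcon
    rw [Metric.tendsto_nhds] at hcon
    push Not at hcon
    obtain ⟨ε, hε, hfr⟩ := hcon
    simp only [dist_eq_norm] at hfr
    have hne : (l ⊓ 𝓟 {w | ε ≤ ‖g w - g 0‖}).NeBot := by
      rwa [← frequently_mem_iff_neBot]
    -- Boundedness of `g` and an ultrafilter give the jumps a single limit `L`, with norm at least
    -- `ε`.
    obtain ⟨u, hu⟩ : ∃ u : Ultrafilter C₀(ℕ, 𝕜), ↑u ≤ l ⊓ 𝓟 {w | ε ≤ ‖g w - g 0‖} :=
      ⟨Ultrafilter.of _, Ultrafilter.of_le _⟩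
    have hul : ↑u ≤ l := hu.trans inf_le_left
    have huR : ∀ᶠ w in (u : Filter C₀(ℕ, 𝕜)), ‖w‖ ≤ R := hul hR
    have huw : ∀ i, Tendsto (fun w : C₀(ℕ, 𝕜) => w i) u (𝓝 0) := fun i => (hw i).mono_left hul
    have huε : ∀ᶠ w in (u : Filter C₀(ℕ, 𝕜)), ε ≤ ‖g w - g 0‖ :=
      hu (mem_inf_of_right (mem_principal_self _))
    obtain ⟨M, hM⟩ := hg R
    obtain ⟨L, -, hL⟩ := (isCompact_closedBall (0 : 𝕜) (M + ‖g 0‖)).ultrafilter_le_nhds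
      (u.map fun w => g w - g 0) (by
        rw [le_principal_iff]
        change ∀ᶠ w in (u : Filter C₀(ℕ, 𝕜)), g w - g 0 ∈ _
        filter_upwards [huR] with w hw
        simpa using (norm_sub_le _ _).trans (add_le_add_left (hM w hw) _))
    have hL' : Tendsto (fun w => g w - g 0) u (𝓝 L) := hL
    have hLε : ε ≤ ‖L‖ := ge_of_tendsto hL'.norm huε
    have hstep : ∀ h, Tendsto (fun w => g (w + h) - g h) u (𝓝 L) := by
      intro h
      have := (tendsto_sub_sub hΔ huR huw h).add hL'
      rw [zero_add] at this
      refine this.congr fun w => ?_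
      ring
    -- Stacking `n` humps adds nearly `L` each time while the norm stays at most `|R| + 1`, so `g`
    -- would be unbounded on a ball.
    have hind : ∀ n : ℕ, ∃ h : C₀(ℕ, 𝕜), (∀ i, ‖h i‖ < |R| + 1) ∧
        ‖g h - g 0 - n * L‖ ≤ n * (‖L‖ / 2) := by
      intro n
      induction n with
      | zero => exact ⟨0, fun i => by simp; positivity, by simp⟩
      | succ n ih =>
        obtain ⟨h, hh, hgh⟩ := ih
        have hG : Tendsto (fun i => ‖h i‖) atTop (𝓝 0) := by simpa using (c0_tendsto h).norm
        have e1 := eventually_add_norm_lt hG hh (lt_of_le_of_lt (le_abs_self R) (lt_add_one _))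
          huR huw
        have e2 := (Metric.tendsto_nhds.1 (hstep h)) (‖L‖ / 2) (by linarith)
        obtain ⟨w, hw1, hw2⟩ := (e1.and e2).exists
        refine ⟨w + h, fun i => lt_of_le_of_lt ?_ (hw1 i), ?_⟩
        · rw [add_comm]
          exact norm_add_le _ _
        · rw [dist_eq_norm] at hw2
          have : g (w + h) - g 0 - (n + 1 : ℕ) * L
            = (g h - g 0 - n * L) + (g (w + h) - g h - L) := by push_cast; ring
          rw [this]
          refine (norm_add_le _ _).trans ?_
          push_cast
          linarith
    obtain ⟨M', hM'⟩ := hg (|R| + 1)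
    obtain ⟨n, hn⟩ := exists_nat_gt ((M' + ‖g 0‖) / (‖L‖ / 2))
    obtain ⟨h, hh, hgh⟩ := hind n
    have h1 := hM' h ((c0_norm_le (by positivity)).2 fun i => (hh i).le)
    rw [div_lt_iff₀ (by linarith)] at hn
    have h2 : ‖(n : 𝕜) * L‖ = n * ‖L‖ := by rw [norm_mul, RCLike.norm_natCast]
    have h3 : ‖(n : 𝕜) * L‖ ≤ ‖g h - g 0‖ + ‖g h - g 0 - n * L‖ := by
      have := norm_sub_le (g h - g 0) (g h - g 0 - n * L)
      rwa [sub_sub_cancel] at this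
    have h4 := norm_sub_le (g h) (g 0)
    nlinarith

end

/-! ### Gliding hump: from convergence along series to coordinatewise continuity -/

section
variable {𝕜 : Type*} [RCLike 𝕜] {Y : Type*} [NormedAddCommGroup Y]

/-- If continuity at 0 failed by `ε`, humps could be chosen one after another, each moving `g` by at
least `ε / 2`, with the sums of moduli uniformly bounded in every coordinate. Along their partial
sums `g` would not be Cauchy. -/
theorem coordCont_of_cauchySeq {k : ℕ} {g : C₀(ℕ, 𝕜) → Y} (hg : DegLE k g)
    (hs : ∀ w : ℕ → C₀(ℕ, 𝕜), (∃ B : ℝ, ∀ i N, ∑ n ∈ Finset.range N, ‖w n i‖ ≤ B) →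
      CauchySeq fun N => g (∑ n ∈ Finset.range N, w n)) : CoordCont g := by
  refine coordCont_of_degLE {g | ∀ w : ℕ → C₀(ℕ, 𝕜),
    (∃ B : ℝ, ∀ i N, ∑ n ∈ Finset.range N, ‖w n i‖ ≤ B) →
      CauchySeq fun N => g (∑ n ∈ Finset.range N, w n)} ?_ ?_ k g hg hs
  · rintro g hg h w ⟨B, hB⟩
    refine uniformContinuous_sub.comp_cauchySeq (CauchySeq.prodMk ?_ (hg w ⟨B, hB⟩))
    -- Prepending `h` to the series translates its partial sums by `h`.
    have h1 := hg (fun n => Nat.casesOn n h w) ⟨‖h‖ + B, fun i N => ?_⟩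
    · have h2 := h1.comp_tendsto (tendsto_add_atTop_nat 1)
      simpa [Function.comp_def, Finset.sum_range_succ'] using h2
    · cases N with
      | zero =>
        have := hB 0 0
        simp at this ⊢
        positivity
      | succ N =>
        rw [Finset.sum_range_succ', add_comm]
        exact add_le_add (c0_norm_apply_le h i) (hB i N)
  · clear! g
    intro g hg hΔ l R hR hw
    by_contra hcon
    rw [Metric.tendsto_nhds] at hcon
    push Not at hcon
    obtain ⟨ε, hε, hfr⟩ := hcon
    simp only [dist_eq_norm] at hfr
    -- A state is a partial sum of humps together with the coordinatewise sum of their moduli.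
    let State := {s : C₀(ℕ, 𝕜) × (ℕ → ℝ) // Tendsto s.2 atTop (𝓝 0) ∧ ∀ i, s.2 i < |R| + 1}
    have hstep : ∀ s : State, ∃ w : C₀(ℕ, 𝕜), (∀ i, s.1.2 i + ‖w i‖ < |R| + 1) ∧
        ε / 2 ≤ ‖g (w + s.1.1) - g s.1.1‖ := by
      intro s
      have e1 := eventually_add_norm_lt s.2.1 s.2.2
        (lt_of_le_of_lt (le_abs_self R) (lt_add_one _)) hR hw
      have e2 := (Metric.tendsto_nhds.1 (tendsto_sub_sub hΔ hR hw s.1.1)) _ (half_pos hε)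
      obtain ⟨w, hw0, hw1, hw2⟩ := (hfr.and_eventually (e1.and e2)).exists
      refine ⟨w, hw1, ?_⟩
      rw [dist_zero_right] at hw2
      have h1 : g w - g 0 = (g (w + s.1.1) - g s.1.1) -
        ((g (w + s.1.1) - g w) - (g s.1.1 - g 0)) := by abel
      rw [h1] at hw0
      have := norm_sub_le (g (w + s.1.1) - g s.1.1)
        ((g (w + s.1.1) - g w) - (g s.1.1 - g 0))
      linarith
    choose W hW1 hW2 using hstep
    let next : State → State := fun s =>
      ⟨(W s + s.1.1, fun i => s.1.2 i + ‖W s i‖), by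
        simpa using s.2.1.add (c0_tendsto (W s)).norm, hW1 s⟩
    let st : ℕ → State := fun n => next^[n]
      ⟨(0, fun _ => 0), tendsto_const_nhds, fun _ => by positivity⟩
    have hst : ∀ n, st (n + 1) = next (st n) := fun n => Function.iterate_succ_apply' _ _ _
    have hH : ∀ n, (st n).1.1 = ∑ m ∈ Finset.range n, W (st m) := by
      intro n
      induction n with
      | zero => rfl
      | succ n ih =>
        rw [Finset.sum_range_succ, ← ih, hst]
        exact add_comm _ _
    have hG : ∀ i n, (st n).1.2 i = ∑ m ∈ Finset.range n, ‖W (st m) i‖ := by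
      intro i n
      induction n with
      | zero => rfl
      | succ n ih =>
        rw [Finset.sum_range_succ, ← ih, hst]
    have hc := hg (fun n => W (st n)) ⟨|R| + 1, fun i n => by
      rw [← hG]
      exact ((st n).2.2 i).le⟩
    simp only [← hH] at hc
    obtain ⟨N, hN⟩ := Metric.cauchySeq_iff.1 hc _ (half_pos hε)
    have h1 := hN (N + 1) (by simp) N le_rfl
    rw [dist_eq_norm, hst] at h1
    exact absurd (hW2 (st N)) (not_le.2 h1)

end

/-! ### Baire category on ℓ^∞: from weak to norm continuity -/

section
variable {𝕜 : Type*} [RCLike 𝕜] {Y : Type*} [NormedAddCommGroup Y] [NormedSpace 𝕜 Y]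

/-- Coordinatewise-to-weak continuity on bounded subsets of `ℓ^∞`. -/
def WeakCoordCont (f : (ℕ →ᵇ 𝕜) → Y) : Prop :=
  ∀ (φ : StrongDual 𝕜 Y) (l : Filter (ℕ →ᵇ 𝕜)) (R : ℝ) (b : ℕ →ᵇ 𝕜),
    (∀ᶠ x in l, ‖x‖ ≤ R) → (∀ i, Tendsto (fun x : ℕ →ᵇ 𝕜 => x i) l (𝓝 (b i))) →
    Tendsto (fun x => φ (f x)) l (𝓝 (φ (f b)))

/-- Coordinatewise-to-norm continuity on bounded subsets of `ℓ^∞`. -/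
def NormCoordCont (f : (ℕ →ᵇ 𝕜) → Y) : Prop :=
  ∀ (l : Filter (ℕ →ᵇ 𝕜)) (R : ℝ) (b : ℕ →ᵇ 𝕜),
    (∀ᶠ x in l, ‖x‖ ≤ R) → (∀ i, Tendsto (fun x : ℕ →ᵇ 𝕜 => x i) l (𝓝 (b i))) →
    Tendsto f l (𝓝 (f b))

/-- Hahn–Banach in the quotient by `S`. -/
theorem mem_of_forall_dual_eq_zero {S : Submodule 𝕜 Y} (hS : IsClosed (S : Set Y)) {y : Y}
    (h : ∀ φ : StrongDual 𝕜 Y, (∀ s ∈ S, φ s = 0) → φ y = 0) : y ∈ S := by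
  have : IsClosed (S.toAddSubgroup : Set Y) := hS
  by_contra hy
  have hne : S.mkQ y ≠ 0 := by simpa using hy
  obtain ⟨φ, -, hφ⟩ := exists_dual_vector 𝕜 (S.mkQ y) (by simpa using hne)
  have hc : Continuous S.mkQ := continuous_quot_mk
  have := h (φ.comp ⟨S.mkQ, hc⟩) (fun s hs => by
    have : S.mkQ s = 0 := by simpa using hs
    change φ (S.mkQ s) = 0
    rw [this, map_zero])
  change φ (S.mkQ y) = 0 at this
  rw [hφ] at this
  simp only [RCLike.ofReal_eq_zero, norm_eq_zero] at this
  exact hne this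

theorem isClosed_preimage_closedBall {K : Type*} [TopologicalSpace K] {F : K → Y}
    (hF : ∀ φ : StrongDual 𝕜 Y, Continuous fun x => φ (F x)) (y : Y) {ε : ℝ} (hε : 0 ≤ ε) :
    IsClosed {x | ‖F x - y‖ ≤ ε} := by
  have : {x | ‖F x - y‖ ≤ ε} = ⋂ φ : StrongDual 𝕜 Y, {x | ‖φ (F x) - φ y‖ ≤ ε * ‖φ‖} := by
    ext x
    simp only [Set.mem_ofPred_eq, Set.mem_iInter]
    constructor
    · intro h φ
      rw [← map_sub]
      refine (φ.le_opNorm _).trans ?_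
      rw [mul_comm]
      gcongr
    · intro h
      refine NormedSpace.norm_le_dual_bound 𝕜 _ hε fun φ => ?_
      rw [map_sub]
      exact h φ
  rw [this]
  exact isClosed_iInter fun φ => isClosed_le ((hF φ).sub continuous_const).norm continuous_const

/-- A weakly continuous function on a separable Baire space has a small oscillation on some
nonempty open set. -/
theorem exists_open_norm_sub_le {K : Type*} [TopologicalSpace K] [BaireSpace K] [Nonempty K]
    [SeparableSpace K] {F : K → Y}
    (hF : ∀ φ : StrongDual 𝕜 Y, Continuous fun x => φ (F x)) {ε : ℝ} (hε : 0 < ε) :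
    ∃ U : Set K, IsOpen U ∧ U.Nonempty ∧ ∀ x ∈ U, ∀ y ∈ U, ‖F x - F y‖ ≤ ε := by
  let S := (Submodule.span 𝕜 (Set.range fun n => F (denseSeq K n))).topologicalClosure
  have hsep : IsSeparable (S : Set Y) :=
    ((Set.countable_range _).isSeparable.span).closure
  -- Weak continuity puts all values in the closed span of the values on a dense sequence. Countably
  -- many small balls then cover the range, and their preimages are closed.
  have hFS : ∀ x, F x ∈ S := by
    intro x
    refine mem_of_forall_dual_eq_zero (𝕜 := 𝕜)
      (Submodule.isClosed_topologicalClosure _) fun φ hφ => ?_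
    have hcl : IsClosed {x | φ (F x) = 0} := isClosed_eq (hF φ) continuous_const
    have : closure (Set.range (denseSeq K)) ⊆ {x | φ (F x) = 0} := by
      refine hcl.closure_subset_iff.2 ?_
      rintro _ ⟨n, rfl⟩
      exact hφ _ (Submodule.le_topologicalClosure _ (Submodule.subset_span ⟨n, rfl⟩))
    exact this (denseRange_denseSeq K x)
  obtain ⟨c, hc, hcS⟩ := hsep
  have : Countable c := hc
  obtain ⟨⟨y, hy⟩, hint⟩ := nonempty_interior_of_iUnion_of_closed
    (f := fun y : c => {x | ‖F x - y‖ ≤ ε / 2})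
    (fun y => isClosed_preimage_closedBall hF _ (by positivity)) (by
      refine Set.eq_univ_of_forall fun x => Set.mem_iUnion.2 ?_
      obtain ⟨y, hy, hxy⟩ := Metric.mem_closure_iff.1 (hcS (hFS x)) (ε / 2) (by positivity)
      exact ⟨⟨y, hy⟩, by simpa [dist_eq_norm] using hxy.le⟩)
  refine ⟨_, isOpen_interior, hint, fun x hx x' hx' => ?_⟩
  have h1 : x ∈ {x | ‖F x - y‖ ≤ ε / 2} := interior_subset hx
  have h2 : x' ∈ {x | ‖F x - y‖ ≤ ε / 2} := interior_subset hx'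
  have := norm_sub_le (F x - y) (F x' - y)
  rw [sub_sub_sub_cancel_right] at this
  rw [Set.mem_ofPred_eq] at h1 h2
  linarith

theorem tendsto_truncated_scaling (c : ℕ → 𝕜) :
    Tendsto (fun n : ℕ => fun i => if i < n then ((1 - 1 / ((n : ℝ) + 1) : ℝ) : 𝕜) * c i else 0)
      atTop (𝓝 c) := by
  rw [tendsto_pi_nhds]
  intro i
  have h1 : Tendsto (fun n : ℕ => (1 - 1 / ((n : ℝ) + 1) : ℝ)) atTop (𝓝 1) := by
    simpa using tendsto_const_nhds.sub (tendsto_one_div_add_atTop_nhds_zero_nat (𝕜 := ℝ))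
  have h2 : Tendsto (fun n : ℕ => ((1 - 1 / ((n : ℝ) + 1) : ℝ) : 𝕜) * c i) atTop (𝓝 (c i)) := by
    have := ((RCLike.continuous_ofReal (K := 𝕜)).tendsto 1).comp h1
    simpa using this.mul_const (c i)
  refine h2.congr' ?_
  filter_upwards [eventually_gt_atTop i] with n hn
  simp [hn]

/-- The ball of ℓ^∞ is a compact metrizable product of discs, so Baire gives an open set of small
oscillation. Its point is replaced by a finitely supported one, scaled into the interior on its
support: adding `w` of norm at most `R` that is small on the support then stays in the ball. -/
theorem WeakCoordCont.exists_small_osc {f : (ℕ →ᵇ 𝕜) → Y} (hf : WeakCoordCont f) {R : ℝ}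
    (hR : 0 < R) {ε : ℝ} (hε : 0 < ε) :
    ∃ c : ℕ →ᵇ 𝕜, ∀ l : Filter (ℕ →ᵇ 𝕜), (∀ᶠ w in l, ‖w‖ ≤ R) →
      (∀ i, Tendsto (fun w : ℕ →ᵇ 𝕜 => w i) l (𝓝 0)) → ∀ᶠ w in l, ‖f (c + w) - f c‖ ≤ ε := by
  let s : Set (ℕ → 𝕜) := Set.pi Set.univ fun _ => Metric.closedBall 0 R
  have hs : ∀ x : ℕ → 𝕜, x ∈ s ↔ ∀ i, ‖x i‖ ≤ R := fun x => by simp [s, Set.mem_pi]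
  have hsc : IsCompact s := isCompact_univ_pi fun _ => isCompact_closedBall _ _
  have : CompactSpace s := isCompact_iff_compactSpace.1 hsc
  have : Nonempty s := ⟨⟨0, (hs 0).2 fun i => by simpa using hR.le⟩⟩
  let J : s → ℕ →ᵇ 𝕜 := fun x => ofNormedAddCommGroupDiscrete x.1 R ((hs x.1).1 x.2)
  have hJ : ∀ x i, J x i = x.1 i := fun _ _ => rfl
  have hcont : ∀ φ : StrongDual 𝕜 Y, Continuous fun x : s => φ (f (J x)) := by
    intro φ
    rw [continuous_iff_continuousAt]
    intro x
    have := hf φ ((𝓝 x).map J) R (J x) (by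
        rw [eventually_map]
        exact Eventually.of_forall fun y =>
          (BoundedContinuousFunction.norm_le hR.le).2 ((hs y.1).1 y.2)) (fun i => by
        rw [tendsto_map'_iff]
        exact ((continuous_apply i).comp continuous_subtype_val).tendsto x)
    exact tendsto_map'_iff.1 this
  obtain ⟨U, hU, ⟨x0, hx0⟩, hUF⟩ := exists_open_norm_sub_le hcont hε
  obtain ⟨V, hV, rfl⟩ := isOpen_induced_iff.1 hU
  obtain ⟨n, hn⟩ := ((tendsto_truncated_scaling x0.1).eventually (hV.mem_nhds hx0)).exists
  set c : ℕ → 𝕜 := fun i => if i < n then ((1 - 1 / ((n : ℝ) + 1) : ℝ) : 𝕜) * x0.1 i else 0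
    with hc
  have hn0 : (0 : ℝ) < 1 / ((n : ℝ) + 1) := by positivity
  have hn1 : 1 / ((n : ℝ) + 1) ≤ 1 := by
    rw [div_le_one (by positivity)]
    simp
  have hci : ∀ i < n, ‖c i‖ ≤ R - 1 / ((n : ℝ) + 1) * R := by
    intro i hi
    simp only [hc, hi, if_true]
    rw [norm_mul, RCLike.norm_ofReal, abs_of_nonneg (by linarith)]
    have := (hs _).1 x0.2 i
    nlinarith
  have hci' : ∀ i, ¬ i < n → c i = 0 := fun i hi => by simp [hc, hi]
  have hcs : c ∈ s := (hs c).2 fun i => by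
    by_cases hi : i < n
    · have := hci i hi
      nlinarith
    · rw [hci' i hi]
      simpa using hR.le
  refine ⟨J ⟨c, hcs⟩, fun l hlR hl => ?_⟩
  have e1 : ∀ᶠ w : ℕ →ᵇ 𝕜 in l, ∀ i ∈ Finset.range n, ‖w i‖ < 1 / ((n : ℝ) + 1) * R := by
    rw [Finset.eventually_all]
    intro i _
    have := (hl i).norm
    rw [norm_zero] at this
    exact this.eventually (gt_mem_nhds (by positivity))
  have e2 : ∀ᶠ w : ℕ →ᵇ 𝕜 in l, c + ⇑w ∈ V := by
    have : Tendsto (fun w : ℕ →ᵇ 𝕜 => c + ⇑w) l (𝓝 c) := by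
      rw [tendsto_pi_nhds]
      intro i
      simpa using (hl i).const_add (c i)
    exact this.eventually (hV.mem_nhds hn)
  filter_upwards [e1, e2, hlR] with w hw1 hw2 hw3
  have hmem : c + ⇑w ∈ s := (hs _).2 fun i => by
    by_cases hi : i < n
    · have h1 := hci i hi
      have h2 := hw1 i (Finset.mem_range.2 hi)
      exact (norm_add_le _ _).trans (by linarith)
    · simp only [Pi.add_apply, hci' i hi, zero_add]
      exact (w.norm_coe_le_norm i).trans hw3
  have heq : J ⟨c, hcs⟩ + w = J ⟨_, hmem⟩ := by
    ext i
    rfl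
  rw [heq]
  exact hUF _ hw2 _ hn

/-- A function of finite degree on `ℓ^∞` that is coordinatewise-to-weakly continuous on bounded
sets is coordinatewise-to-norm continuous on bounded sets. -/
theorem WeakCoordCont.normCoordCont {k : ℕ} {f : (ℕ →ᵇ 𝕜) → Y} (hk : DegLE k f)
    (hf : WeakCoordCont f) : NormCoordCont f := by
  induction k generalizing f with
  | zero =>
    intro l R b _ _
    have : f = fun _ => f b := funext fun x => hk x b
    rw [this]
    exact tendsto_const_nhds
  | succ k ih =>
    have hsh : ∀ h : ℕ →ᵇ 𝕜, WeakCoordCont fun x => f (x + h) := by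
      intro h φ l R b hR hb
      have := hf φ (l.map fun x => x + h) (R + ‖h‖) (b + h) (by
        rw [eventually_map]
        filter_upwards [hR] with x hx
        exact (norm_add_le _ _).trans (by gcongr)) (fun i => tendsto_map'_iff.2 (by
          simpa [Function.comp_def] using (hb i).add_const (h i)))
      exact tendsto_map'_iff.1 this
    have hΔ : ∀ h, NormCoordCont fun x => f (x + h) - f x := by
      intro h
      refine ih (hk h) fun φ l R b hR hb => ?_
      simp only [map_sub]
      exact (hsh h φ l R b hR hb).sub (hf φ l R b hR hb)
    intro l R b hR hb
    rw [Metric.tendsto_nhds]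
    intro ε hε
    -- One point `c` of small oscillation is enough: the increment by `b - c` is continuous by
    -- induction and transports the estimate from `c` to `b`.
    obtain ⟨c, hc⟩ := hf.exists_small_osc (R := |R| + ‖b‖ + 1) (by positivity) (half_pos hε)
    have e1 := hc (l.map fun x => x - b) (by
      rw [eventually_map]
      filter_upwards [hR] with x hx
      have := norm_sub_le x b
      have := le_abs_self R
      linarith) (fun i => tendsto_map'_iff.2 (by
        simpa [Function.comp_def] using (hb i).sub_const (b i)))
    rw [eventually_map] at e1
    have e2 := hΔ (b - c) (l.map fun x => c + (x - b)) (‖c‖ + (R + ‖b‖)) c (by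
      rw [eventually_map]
      filter_upwards [hR] with x hx
      exact (norm_add_le _ _).trans (by
        gcongr
        exact (norm_sub_le _ _).trans (by gcongr))) (fun i => tendsto_map'_iff.2 (by
        simpa [Function.comp_def] using ((hb i).sub_const (b i)).const_add (c i)))
    have e3 := Metric.tendsto_nhds.1 (tendsto_map'_iff.1 e2) _ (half_pos hε)
    filter_upwards [e1, e3] with x h1 h2
    simp only [Function.comp_apply, dist_eq_norm] at h2 ⊢
    have a1 : c + (x - b) + (b - c) = x := by abel
    have a2 : c + (b - c) = b := by abel
    rw [a1, a2] at h2
    have a3 : f x - f b = (f x - f (c + (x - b)) - (f b - f c)) + (f (c + (x - b)) - f c) := by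
      abel
    rw [a3]
    refine (norm_add_le _ _).trans_lt ?_
    linarith

end

/-! ### Polynomials have finite degree -/

section degree

theorem DegLE.comp_addMonoidHom {D E F : Type*} [AddCommGroup D] [AddCommGroup E] [AddCommGroup F]
    {k : ℕ} {f : E → F} (hf : DegLE k f) (A : D →+ E) : DegLE k (fun x => f (A x)) := by
  induction k generalizing f with
  | zero => exact fun x y => hf _ _
  | succ k ih =>
    intro h
    simpa only [map_add] using ih (hf (A h))

theorem DegLE.sum {E F ι : Type*} [AddCommGroup E] [AddCommGroup F] {k : ℕ} {f : ι → E → F}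
    {s : Finset ι} (hf : ∀ i ∈ s, DegLE k (f i)) : DegLE k (fun x => ∑ i ∈ s, f i x) := by
  induction k generalizing f with
  | zero => exact fun x y => Finset.sum_congr rfl fun i hi => hf i hi x y
  | succ k ih =>
    intro h
    simpa only [Finset.sum_sub_distrib] using ih fun i hi => hf i hi h

/-- Expanding by multilinearity, the term with `x` in all slots of `s` cancels in the difference;
every other term has strictly fewer variable slots. -/
theorem degLE_multilinear_piecewise {𝕜 : Type*} [RCLike 𝕜]
    {X : Type*} [NormedAddCommGroup X] [NormedSpace 𝕜 X]
    {Y : Type*} [NormedAddCommGroup Y] [NormedSpace 𝕜 Y] {k : ℕ}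
    (M : ContinuousMultilinearMap 𝕜 (fun _ : Fin k => X) Y) (n : ℕ) (s : Finset (Fin k))
    (hs : s.card ≤ n) (c : Fin k → X) :
    DegLE n (fun x => M (s.piecewise (fun _ => x) c)) := by
  induction n generalizing s c with
  | zero =>
    have : s = ∅ := by simpa using hs
    subst this
    exact fun x y => by simp
  | succ n ih =>
    intro h
    have key : (fun x => M (s.piecewise (fun _ => x + h) c) - M (s.piecewise (fun _ => x) c)) =
        fun x => ∑ t ∈ s.powerset.erase s,
          M (t.piecewise (fun _ => x) (s.piecewise (fun _ => h) c)) := by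
      funext x
      have h1 := M.map_piecewise_add (fun _ => x) (s.piecewise (fun _ => h) c) s
      rw [← Finset.add_sum_erase _ _ (Finset.mem_powerset_self s)] at h1
      have h2 : s.piecewise ((fun _ => x) + s.piecewise (fun _ => h) c)
          (s.piecewise (fun _ => h) c) = s.piecewise (fun _ => x + h) c := by
        funext i
        by_cases hi : i ∈ s <;> simp [hi]
      have h3 : s.piecewise (fun _ => x) (s.piecewise (fun _ => h) c) =
          s.piecewise (fun _ => x) c := by
        funext i
        by_cases hi : i ∈ s <;> simp [hi]
      rw [h2, h3] at h1
      rw [h1, add_sub_cancel_left]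
    rw [key]
    refine DegLE.sum fun t ht => ih t ?_ _
    rw [Finset.mem_erase, Finset.mem_powerset] at ht
    have := Finset.card_lt_card (ht.2.ssubset_of_ne ht.1)
    omega

variable {𝕜 : Type*} [RCLike 𝕜]
    {X : Type*} [NormedAddCommGroup X] [NormedSpace 𝕜 X]
    {Y : Type*} [NormedAddCommGroup Y] [NormedSpace 𝕜 Y] {k : ℕ} {P : X → Y}

theorem IsHomogeneousPolynomial.degLE (hP : IsHomogeneousPolynomial 𝕜 k P) : DegLE k P := by
  obtain ⟨M, hM⟩ := hP
  have := degLE_multilinear_piecewise M k Finset.univ (by simp) 0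
  simp only [Finset.piecewise_univ] at this
  rwa [funext hM]

theorem IsHomogeneousPolynomial.bounded (hP : IsHomogeneousPolynomial 𝕜 k P) (R : ℝ) :
    ∃ B, ∀ x, ‖x‖ ≤ R → ‖P x‖ ≤ B := by
  obtain ⟨M, hM⟩ := hP
  refine ⟨‖M‖ * R ^ k, fun x hx => ?_⟩
  rw [hM]
  refine (M.le_opNorm _).trans ?_
  simp only [Finset.prod_const, Finset.card_univ, Fintype.card_fin]
  gcongr

theorem IsHomogeneousPolynomial.map_smul (hP : IsHomogeneousPolynomial 𝕜 k P) (c : 𝕜) (x : X) :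
    P (c • x) = c ^ k • P x := by
  obtain ⟨M, hM⟩ := hP
  rw [hM, hM]
  simpa using M.map_smul_univ (fun _ => c) (fun _ => x)

theorem isHomogeneousPolynomial_id : IsHomogeneousPolynomial 𝕜 1 (id : X → X) :=
  ⟨ContinuousMultilinearMap.ofSubsingleton 𝕜 X X 0 (ContinuousLinearMap.id 𝕜 X), fun x => by simp⟩

theorem IsHomogeneousPolynomial.comp {Z : Type*} [NormedAddCommGroup Z] [NormedSpace 𝕜 Z]
    (hP : IsHomogeneousPolynomial 𝕜 k P) (T : Z →L[𝕜] X) :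
    IsHomogeneousPolynomial 𝕜 k (fun z => P (T z)) := by
  obtain ⟨M, hM⟩ := hP
  exact ⟨M.compContinuousLinearMap fun _ => T, fun x => by simp [hM]⟩

theorem IsHomogeneousPolynomial.dual_comp (hP : IsHomogeneousPolynomial 𝕜 k P)
    (φ : StrongDual 𝕜 Y) : IsHomogeneousPolynomial 𝕜 k (fun z => φ (P z)) := by
  obtain ⟨M, hM⟩ := hP
  exact ⟨φ.compContinuousMultilinearMap M, fun x => by simp [hM]⟩

end degree

/-! ### Precompactness of images of balls -/

section
variable {𝕜 : Type*} [RCLike 𝕜] {Y : Type*} [NormedAddCommGroup Y]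

theorem CoordCont.cauchy_map {g : C₀(ℕ, 𝕜) → Y} (hg : CoordCont g) {ι : Type*} {l : Filter ι}
    [l.NeBot] {x : ι → C₀(ℕ, 𝕜)} {R : ℝ} (hR : ∀ᶠ p in l, ‖x p‖ ≤ R) {b : ℕ → 𝕜}
    (hb : ∀ i, Tendsto (fun p => x p i) l (𝓝 (b i))) : Cauchy (l.map fun p => g (x p)) := by
  rw [cauchy_map_iff]
  refine ⟨inferInstance, ?_⟩
  rw [uniformity_eq_comap_nhds_zero_swapped, tendsto_comap_iff]
  exact hg.tendsto_sub (l := l ×ˢ l) (x := fun p => x p.1) (y := fun p => x p.2)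
    (tendsto_fst.eventually hR) (tendsto_snd.eventually hR)
    (fun i => (hb i).comp tendsto_fst) (fun i => (hb i).comp tendsto_snd)

/-- Along an ultrafilter on the ball every coordinate converges. The limit sequence may leave c₀,
which `CoordCont` allows, so the images form a Cauchy filter. -/
theorem CoordCont.isRelCompact [CompleteSpace Y] {g : C₀(ℕ, 𝕜) → Y} (hg : CoordCont g) (R : ℝ) :
    IsRelCompact (g '' Metric.closedBall 0 R) := by
  refine TotallyBounded.isCompact_of_isClosed ?_ isClosed_closure
  refine TotallyBounded.closure ?_
  rw [totallyBounded_iff_ultrafilter]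
  intro v hv
  have hv' : g '' Metric.closedBall 0 R ∈ v := le_principal_iff.1 hv
  let u := Ultrafilter.ofComapInfPrincipal hv'
  have huv : Ultrafilter.map g u = v := Ultrafilter.ofComapInfPrincipal_eq_of_map hv'
  have huR : Metric.closedBall 0 R ∈ u := Ultrafilter.ofComapInfPrincipal_mem hv'
  have hb : ∀ i, ∃ z : 𝕜, Tendsto (fun x : C₀(ℕ, 𝕜) => x i) u (𝓝 z) := by
    intro i
    obtain ⟨z, -, hz⟩ := (isCompact_closedBall (0 : 𝕜) R).ultrafilter_le_nhds
      (u.map fun x => x i) (by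
        rw [le_principal_iff]
        change ∀ᶠ x : C₀(ℕ, 𝕜) in (u : Filter C₀(ℕ, 𝕜)), x i ∈ Metric.closedBall 0 R
        filter_upwards [huR] with x hx
        simp only [mem_closedBall_zero_iff] at hx ⊢
        exact (c0_norm_apply_le x i).trans hx)
    exact ⟨z, hz⟩
  choose b hb using hb
  rw [← huv]
  exact hg.cauchy_map (l := (u : Filter C₀(ℕ, 𝕜))) (x := fun x => x) (R := R)
    (by
      filter_upwards [huR] with x hx
      simpa using hx) hb

theorem IsRelCompact.mono {A B : Set Y} (hA : IsRelCompact A) (h : B ⊆ A) : IsRelCompact B :=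
  IsCompact.of_isClosed_subset hA isClosed_closure (closure_mono h)

end

/-! ### From weak compactness to coordinatewise continuity -/

section
variable {𝕜 : Type*} [RCLike 𝕜] {Y : Type*} [NormedAddCommGroup Y] [NormedSpace 𝕜 Y]

theorem eq_of_forall_dual {x y : Y} (h : ∀ φ : StrongDual 𝕜 Y, φ x = φ y) : x = y :=
  (SeparatingDual.eq_iff_forall_dual_eq (R := 𝕜)).2 h

theorem DegLE.of_weak_limit {E : Type*} [AddCommGroup E] {k : ℕ} {G : ℕ → E → Y} {f : E → Y}
    (hG : ∀ n, DegLE k (G n))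
    (hf : ∀ (φ : StrongDual 𝕜 Y) x, Tendsto (fun n => φ (G n x)) atTop (𝓝 (φ (f x)))) :
    DegLE k f := by
  induction k generalizing G f with
  | zero =>
    refine fun x y => eq_of_forall_dual (𝕜 := 𝕜) fun φ => tendsto_nhds_unique (hf φ x) ?_
    simpa only [fun n => hG n x y] using hf φ y
  | succ k ih =>
    refine fun h => ih (fun n => hG n h) fun φ x => ?_
    simpa only [map_sub] using (hf φ (x + h)).sub (hf φ x)

/-- Truncation as an additive map from `ℓ^∞` to `c₀`. -/
def truncHom (𝕜 : Type*) [RCLike 𝕜] (n : ℕ) : (ℕ →ᵇ 𝕜) →+ C₀(ℕ, 𝕜) where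
  toFun b := trunc n b
  map_zero' := by
    ext i
    simp [trunc_apply]
  map_add' x y := by
    ext i
    by_cases hi : i < n <;> simp [trunc_apply, hi]

/-- The weak limits define an extension `f` of `g` to ℓ^∞, of the same degree bound. It is weakly
coordinatewise continuous because each scalar function φ ∘ g is `CoordCont`; then
`WeakCoordCont.normCoordCont` applies, and restriction to c₀ gives the claim. -/
theorem coordCont_of_weak_limits {k : ℕ} {g : C₀(ℕ, 𝕜) → Y} (hg : IsHomogeneousPolynomial 𝕜 k g)
    (hlim : ∀ b : ℕ →ᵇ 𝕜, ∃ y : Y, ∀ φ : StrongDual 𝕜 Y,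
      Tendsto (fun n => φ (g (trunc n b))) atTop (𝓝 (φ y))) : CoordCont g := by
  choose f hf using hlim
  have hφ : ∀ φ : StrongDual 𝕜 Y, CoordCont fun x => φ (g x) := fun φ =>
    coordCont_scalar (hg.dual_comp φ).degLE (hg.dual_comp φ).bounded
  have hdeg : DegLE k f := DegLE.of_weak_limit (𝕜 := 𝕜)
    (fun n => hg.degLE.comp_addMonoidHom (truncHom 𝕜 n)) fun φ x => hf x φ
  have htr : ∀ (n : ℕ) (x : ℕ →ᵇ 𝕜), ‖trunc n x‖ ≤ ‖x‖ := fun n x =>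
    norm_trunc_le (norm_nonneg _) x.norm_coe_le_norm
  have hweak : WeakCoordCont f := by
    intro φ l R b hR hb
    -- The curried filter encodes an iterated limit: for `x` near `b`, the truncations of `x` and
    -- `b` are compared for all large `n`, and then `n` tends to infinity.
    have h1 := (hφ φ).tendsto_sub (l := l.curry atTop) (R := max R ‖b‖)
      (x := fun p : (ℕ →ᵇ 𝕜) × ℕ => trunc p.2 p.1) (y := fun p => trunc p.2 b) (b := b)
      (by
        rw [eventually_curry_iff]
        filter_upwards [hR] with x hx
        exact Eventually.of_forall fun n => (htr n x).trans (hx.trans (le_max_left _ _)))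
      (Eventually.of_forall fun p => (htr _ b).trans (le_max_right _ _))
      (fun i => by
        intro U hU
        rw [mem_map, ← eventually_mem_set, eventually_curry_iff]
        filter_upwards [hb i hU] with x hx
        filter_upwards [eventually_gt_atTop i] with n hn
        simpa [trunc_apply, hn] using hx)
      (fun i => by
        intro U hU
        rw [mem_map, ← eventually_mem_set, eventually_curry_iff]
        refine Eventually.of_forall fun x => ?_
        exact tendsto_trunc_apply b i hU)
    rw [Metric.tendsto_nhds] at h1 ⊢
    intro ε hε
    have h2 := h1 _ (half_pos hε)
    rw [eventually_curry_iff] at h2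
    filter_upwards [h2] with x hx
    have h3 := le_of_tendsto ((hf x φ).sub (hf b φ)).norm (hx.mono fun n hn => by
      rw [dist_zero_right] at hn
      exact hn.le)
    rw [dist_eq_norm]
    linarith
  have hnorm := hweak.normCoordCont hdeg
  have hfg : ∀ a : C₀(ℕ, 𝕜), f a.toBCF = g a := by
    intro a
    refine eq_of_forall_dual (𝕜 := 𝕜) fun φ => tendsto_nhds_unique (hf a.toBCF φ) ?_
    have h1 := (hφ φ).tendsto_sub (l := atTop) (R := ‖a‖) (x := fun n => trunc n a)
      (y := fun _ => a) (b := a) (Eventually.of_forall fun n =>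
        norm_trunc_le (norm_nonneg _) (c0_norm_apply_le a)) (Eventually.of_forall fun _ => le_rfl)
      (tendsto_trunc_apply a) (fun i => tendsto_const_nhds)
    have h2 := h1.add_const (φ (g a))
    simp only [sub_add_cancel, zero_add] at h2
    exact h2
  intro l R b hR h1 h2
  by_cases hl : l = ⊥
  · simp [hl]
  have : l.NeBot := ⟨hl⟩
  let b' : ℕ →ᵇ 𝕜 := ofNormedAddCommGroupDiscrete b R fun i => by
    refine le_of_tendsto (h1 i).norm ?_
    filter_upwards [hR] with p hp
    exact (c0_norm_apply_le _ _).trans hp.1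
  have t1 := hnorm (l.map fun p : C₀(ℕ, 𝕜) × C₀(ℕ, 𝕜) => p.1.toBCF) R b' (by
    rw [eventually_map]
    simpa only [ZeroAtInftyContinuousMap.norm_toBCF_eq_norm] using hR.mono fun p hp => hp.1)
    (fun i => tendsto_map'_iff.2 (h1 i))
  have t2 := hnorm (l.map fun p : C₀(ℕ, 𝕜) × C₀(ℕ, 𝕜) => p.2.toBCF) R b' (by
    rw [eventually_map]
    simpa only [ZeroAtInftyContinuousMap.norm_toBCF_eq_norm] using hR.mono fun p hp => hp.2)
    (fun i => tendsto_map'_iff.2 (h2 i))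
  have t3 := (tendsto_map'_iff.1 t1).sub (tendsto_map'_iff.1 t2)
  simpa [Function.comp_def, hfg] using t3

theorem IsRelCompact.isRelWeaklyCompact {A : Set Y} (hA : IsRelCompact A) :
    IsRelWeaklyCompact 𝕜 A := by
  have h1 : IsCompact (toWeakSpace 𝕜 Y '' closure A) :=
    IsCompact.image hA (toWeakSpaceCLM 𝕜 Y).continuous
  exact h1.closure_of_subset (Set.image_mono subset_closure)

theorem IsRelWeaklyCompact.mono {A B : Set Y} (hA : IsRelWeaklyCompact 𝕜 A) (h : B ⊆ A) :
    IsRelWeaklyCompact 𝕜 B :=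
  IsCompact.of_isClosed_subset hA isClosed_closure (closure_mono (Set.image_mono h))

theorem IsRelWeaklyCompact.exists_weak_limit {y : ℕ → Y}
    (hy : IsRelWeaklyCompact 𝕜 (Set.range y))
    (hc : ∀ φ : StrongDual 𝕜 Y, ∃ c, Tendsto (fun n => φ (y n)) atTop (𝓝 c)) :
    ∃ z, ∀ φ : StrongDual 𝕜 Y, Tendsto (fun n => φ (y n)) atTop (𝓝 (φ z)) := by
  let u : Ultrafilter ℕ := Ultrafilter.of atTop
  have hu : ↑u ≤ (atTop : Filter ℕ) := Ultrafilter.of_le _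
  obtain ⟨z, -, hz⟩ := IsCompact.ultrafilter_le_nhds hy
    (u.map fun n => toWeakSpace 𝕜 Y (y n)) (by
      rw [le_principal_iff]
      change ∀ᶠ n in (u : Filter ℕ), _
      exact Eventually.of_forall fun n => subset_closure ⟨y n, ⟨n, rfl⟩, rfl⟩)
  refine ⟨(toWeakSpace 𝕜 Y).symm z, fun φ => ?_⟩
  obtain ⟨c, hφ⟩ := hc φ
  have h1 : Tendsto (fun n => φ (y n)) u (𝓝 (φ ((toWeakSpace 𝕜 Y).symm z))) :=
    ((WeakBilin.eval_continuous (topDualPairing 𝕜 Y).flip φ).tendsto z).comp hz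
  rwa [tendsto_nhds_unique h1 (hφ.mono_left hu)]

/-- Scalar functions φ ∘ g are `CoordCont`, so `g` is weakly Cauchy along truncations; weak
compactness supplies the limit. Homogeneity rescales a bounded sequence into the unit ball. -/
theorem IsHomogeneousPolynomial.coordCont {k : ℕ} {g : C₀(ℕ, 𝕜) → Y}
    (hg : IsHomogeneousPolynomial 𝕜 k g)
    (h : ∀ a : ℕ → C₀(ℕ, 𝕜), (∀ n, ‖a n‖ ≤ 1) →
      IsRelWeaklyCompact 𝕜 (Set.range fun n => g (a n))) : CoordCont g := by
  refine coordCont_of_weak_limits hg fun b => ?_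
  set c : 𝕜 := ((‖b‖ + 1 : ℝ) : 𝕜) with hc
  have hcn : ‖c‖ = ‖b‖ + 1 := by
    rw [hc, RCLike.norm_ofReal, abs_of_nonneg (by positivity)]
  have hc0 : c ≠ 0 := by
    rw [← norm_pos_iff, hcn]
    positivity
  have hb : ∀ i, ‖(c⁻¹ • b) i‖ ≤ 1 := by
    intro i
    rw [BoundedContinuousFunction.coe_smul, norm_smul, norm_inv, hcn,
      inv_mul_le_iff₀ (by positivity)]
    have := b.norm_coe_le_norm i
    linarith
  have hsc : ∀ n, g (trunc n b) = c ^ k • g (trunc n (c⁻¹ • b)) := by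
    intro n
    rw [← hg.map_smul]
    congr 1
    ext i
    by_cases hi : i < n <;> simp [trunc_apply, hi, hc0]
  obtain ⟨y, hy⟩ := (h (fun n => trunc n (c⁻¹ • b))
    fun n => norm_trunc_le zero_le_one hb).exists_weak_limit (fun φ => by
      have h1 := coordCont_scalar (hg.dual_comp φ).degLE (hg.dual_comp φ).bounded
      exact cauchySeq_tendsto_of_complete (h1.cauchy_map (l := atTop) (R := 1)
        (Eventually.of_forall fun n => norm_trunc_le zero_le_one hb) (tendsto_trunc_apply _)))
  refine ⟨c ^ k • y, fun φ => ?_⟩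
  simp only [hsc, _root_.map_smul]
  exact (hy φ).const_smul _

end

/-! ### W.u.C. series, operators on c₀, and unconditional convergence -/

section
variable {𝕜 : Type*} [RCLike 𝕜]

variable (𝕜) in
/-- The `i`-th unit vector of `c₀`. -/
noncomputable def unitVec (i : ℕ) : C₀(ℕ, 𝕜) where
  toFun j := if j = i then 1 else 0
  continuous_toFun := continuous_of_discreteTopology
  zero_at_infty' := by
    rw [Filter.cocompact_eq_cofinite, Nat.cofinite_eq_atTop]
    refine tendsto_const_nhds.congr' ?_
    filter_upwards [eventually_gt_atTop i] with j hj
    simp [hj.ne']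

theorem unitVec_apply (i j : ℕ) : unitVec 𝕜 i j = if j = i then 1 else 0 := rfl

theorem c0_sum_apply {ι : Type*} (s : Finset ι) (w : ι → C₀(ℕ, 𝕜)) (j : ℕ) :
    (∑ i ∈ s, w i) j = ∑ i ∈ s, w i j := by
  classical
  induction s using Finset.induction_on with
  | empty => simp
  | insert a s ha ih => rw [Finset.sum_insert ha, Finset.sum_insert ha, ← ih]; rfl

theorem sum_smul_unitVec_apply (s : Finset ℕ) (b : ℕ → 𝕜) (j : ℕ) :
    (∑ i ∈ s, b i • unitVec 𝕜 i) j = if j ∈ s then b j else 0 := by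
  rw [c0_sum_apply]
  simp [unitVec_apply]

theorem trunc_eq_sum (n : ℕ) (b : ℕ → 𝕜) :
    trunc n b = ∑ i ∈ Finset.range n, b i • unitVec 𝕜 i := by
  ext j
  rw [sum_smul_unitVec_apply, trunc_apply]
  simp

theorem hasSum_smul_unitVec (a : C₀(ℕ, 𝕜)) : HasSum (fun i => a i • unitVec 𝕜 i) a := by
  rw [HasSum, SummationFilter.unconditional_filter, Metric.tendsto_nhds]
  intro ε hε
  have h0 : Tendsto (fun i => ‖a i‖) atTop (𝓝 0) := by simpa using (c0_tendsto a).norm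
  obtain ⟨N, hN⟩ := eventually_atTop.1 (h0.eventually (gt_mem_nhds (half_pos hε)))
  filter_upwards [eventually_ge_atTop (Finset.range N)] with s hs
  rw [dist_eq_norm]
  refine lt_of_le_of_lt ((c0_norm_le (half_pos hε).le).2 fun j => ?_) (half_lt_self hε)
  rw [ZeroAtInftyContinuousMap.coe_sub, Pi.sub_apply, sum_smul_unitVec_apply]
  split_ifs with hj
  · simpa using (half_pos hε).le
  · rw [zero_sub, norm_neg]
    refine (hN j (not_lt.1 fun h => hj (hs (Finset.mem_range.2 h)))).le

theorem exists_norm_le_one_mul_eq_norm (z : 𝕜) : ∃ θ : 𝕜, ‖θ‖ ≤ 1 ∧ θ * z = (‖z‖ : 𝕜) := by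
  by_cases hz : z = 0
  · exact ⟨0, by simp, by simp [hz]⟩
  · have hz' : ‖z‖ ≠ 0 := norm_ne_zero_iff.2 hz
    have hz'' : (‖z‖ : 𝕜) ≠ 0 := RCLike.ofReal_ne_zero.2 hz'
    refine ⟨(starRingEnd 𝕜) z / (‖z‖ : 𝕜), ?_, ?_⟩
    · rw [norm_div, RCLike.norm_conj, RCLike.norm_ofReal, abs_norm, div_self hz']
    · rw [div_mul_eq_mul_div, RCLike.conj_mul, sq, mul_div_assoc, div_self hz'', mul_one]

theorem isWUC_of_sum_le {w : ℕ → C₀(ℕ, 𝕜)} {B : ℝ}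
    (hw : ∀ i N, ∑ n ∈ Finset.range N, ‖w n i‖ ≤ B) : IsWUC 𝕜 w := by
  intro φ
  have hB : 0 ≤ B := by simpa using hw 0 0
  choose θ hθ1 hθ using fun n => exists_norm_le_one_mul_eq_norm (φ (w n))
  refine summable_of_sum_range_le (c := ‖φ‖ * B) (fun _ => norm_nonneg _) fun N => ?_
  have h1 : φ (∑ n ∈ Finset.range N, θ n • w n) =
      ((∑ n ∈ Finset.range N, ‖φ (w n)‖ : ℝ) : 𝕜) := by
    simp [map_sum, hθ]
  have h2 : ‖∑ n ∈ Finset.range N, θ n • w n‖ ≤ B := by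
    refine (c0_norm_le hB).2 fun i => ?_
    rw [c0_sum_apply]
    refine (norm_sum_le _ _).trans (le_trans (Finset.sum_le_sum fun n _ => ?_) (hw i N))
    rw [ZeroAtInftyContinuousMap.coe_smul, Pi.smul_apply, norm_smul]
    exact mul_le_of_le_one_left (norm_nonneg _) (hθ1 n)
  have h3 := φ.le_opNorm (∑ n ∈ Finset.range N, θ n • w n)
  rw [h1, RCLike.norm_ofReal, abs_of_nonneg (Finset.sum_nonneg fun _ _ => norm_nonneg _)] at h3
  exact h3.trans (by gcongr)

theorem isWUC_unitVec : IsWUC 𝕜 (unitVec 𝕜) := by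
  refine isWUC_of_sum_le (B := 1) fun i N => ?_
  have : ∀ n, ‖unitVec 𝕜 n i‖ = if i = n then 1 else 0 := fun n => by
    rw [unitVec_apply]
    split_ifs <;> simp
  simp only [this, Finset.sum_ite_eq]
  split_ifs <;> simp

variable {X : Type*} [NormedAddCommGroup X] [NormedSpace 𝕜 X]

theorem IsWUC.map {Z : Type*} [NormedAddCommGroup Z] [NormedSpace 𝕜 Z] {w : ℕ → Z}
    (hw : IsWUC 𝕜 w) (T : Z →L[𝕜] X) : IsWUC 𝕜 fun n => T (w n) :=
  fun φ => hw (φ.comp T)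

/-- Uniform boundedness in the bidual: finite sums with coefficients in the unit disc are pointwise
bounded on the dual. -/
theorem IsWUC.exists_bound {x : ℕ → X} (hx : IsWUC 𝕜 x) :
    ∃ C : ℝ, 0 ≤ C ∧ ∀ (s : Finset ℕ) (a : ℕ → 𝕜) (D : ℝ), 0 ≤ D → (∀ i ∈ s, ‖a i‖ ≤ D) →
      ‖∑ i ∈ s, a i • x i‖ ≤ C * D := by
  obtain ⟨C, hC⟩ := banach_steinhaus
    (g := fun p : {p : Finset ℕ × (ℕ → 𝕜) // ∀ i ∈ p.1, ‖p.2 i‖ ≤ 1} =>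
      NormedSpace.inclusionInDoubleDualLi 𝕜 (∑ i ∈ p.1.1, p.1.2 i • x i)) (fun φ => by
      refine ⟨∑' i, ‖φ (x i)‖, ?_⟩
      rintro ⟨⟨s, a⟩, ha⟩
      change ‖φ (∑ i ∈ s, a i • x i)‖ ≤ _
      rw [map_sum]
      refine (norm_sum_le _ _).trans (le_trans (Finset.sum_le_sum fun i hi => ?_)
        ((hx φ).sum_le_tsum s fun _ _ => norm_nonneg _))
      rw [_root_.map_smul, norm_smul]
      exact mul_le_of_le_one_left (norm_nonneg _) (ha i hi))
  simp only [LinearIsometry.norm_map] at hC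
  have hC0 : 0 ≤ C := by simpa using hC ⟨(∅, 0), by simp⟩
  refine ⟨C, hC0, fun s a D hD ha => ?_⟩
  rcases hD.eq_or_lt with rfl | hD
  · rw [Finset.sum_eq_zero fun i hi => by rw [norm_le_zero_iff.1 (ha i hi), zero_smul]]
    simp
  · have hD' : (D : 𝕜) ≠ 0 := RCLike.ofReal_ne_zero.2 hD.ne'
    have h1 := hC ⟨(s, fun i => (D : 𝕜)⁻¹ * a i), fun i hi => by
      rw [norm_mul, norm_inv, RCLike.norm_ofReal, abs_of_pos hD, inv_mul_le_iff₀ hD, mul_one]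
      exact ha i hi⟩
    have h2 : ∑ i ∈ s, a i • x i = (D : 𝕜) • ∑ i ∈ s, ((D : 𝕜)⁻¹ * a i) • x i := by
      rw [Finset.smul_sum]
      refine Finset.sum_congr rfl fun i _ => ?_
      rw [smul_smul, mul_inv_cancel_left₀ hD']
    rw [h2, norm_smul, RCLike.norm_ofReal, abs_of_pos hD, mul_comm]
    gcongr

/-- A weakly unconditionally Cauchy series is the image of the unit vector basis of `c₀` under a
bounded operator. -/
theorem IsWUC.exists_operator [CompleteSpace X] {x : ℕ → X} (hx : IsWUC 𝕜 x) :
    ∃ T : C₀(ℕ, 𝕜) →L[𝕜] X, ∀ i, T (unitVec 𝕜 i) = x i := by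
  obtain ⟨C, hC0, hC⟩ := hx.exists_bound
  have hs : ∀ a : C₀(ℕ, 𝕜), Summable fun i => a i • x i := by
    intro a
    rw [summable_iff_vanishing_norm]
    intro ε hε
    have h0 : Tendsto (fun i => ‖a i‖) atTop (𝓝 0) := by simpa using (c0_tendsto a).norm
    have hε' : 0 < ε / (C + 1) := by positivity
    obtain ⟨N, hN⟩ := eventually_atTop.1 (h0.eventually (gt_mem_nhds hε'))
    refine ⟨Finset.range N, fun t ht => ?_⟩
    refine (hC t a _ hε'.le fun i hi => (hN i ?_).le).trans_lt ?_
    · have := Finset.disjoint_left.1 ht hi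
      simpa using this
    · rw [mul_div_assoc', div_lt_iff₀ (by positivity)]
      nlinarith
  let L : C₀(ℕ, 𝕜) →ₗ[𝕜] X :=
    { toFun := fun a => ∑' i, a i • x i
      map_add' := fun a b => by
        rw [← (hs a).tsum_add (hs b)]
        simp [add_smul]
      map_smul' := fun c a => by
        rw [RingHom.id_apply, ← (hs a).tsum_const_smul]
        simp [mul_smul] }
  refine ⟨L.mkContinuous C fun a => ?_, fun i => ?_⟩
  · refine le_of_tendsto' (hs a).hasSum.norm fun s => ?_
    exact hC s a _ (norm_nonneg _) fun i _ => c0_norm_apply_le a i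
  · change ∑' j, unitVec 𝕜 i j • x j = x i
    rw [tsum_eq_single i fun j hj => by simp [unitVec_apply, hj]]
    simp [unitVec_apply]

theorem map_trunc (T : C₀(ℕ, 𝕜) →L[𝕜] X) (n : ℕ) (b : ℕ → 𝕜) :
    T (trunc n b) = ∑ i ∈ Finset.range n, b i • T (unitVec 𝕜 i) := by
  simp [trunc_eq_sum]

theorem tsum_smul_map_unitVec (T : C₀(ℕ, 𝕜) →L[𝕜] X) (a : C₀(ℕ, 𝕜)) :
    ∑' i, a i • T (unitVec 𝕜 i) = T a := by
  have := (hasSum_smul_unitVec a).mapL T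
  simpa using this.tsum_eq

theorem IsUC.exists_tendsto_indicator {X : Type*} [NormedAddCommGroup X] {x : ℕ → X}
    (hx : IsUC x) (s : Set ℕ) :
    ∃ y, Tendsto (fun n => ∑ i ∈ Finset.range n, s.indicator x i) atTop (𝓝 y) := by
  classical
  rcases s.finite_or_infinite with hs | hs
  · have : Summable (s.indicator x) :=
      summable_of_hasFiniteSupport (hs.subset Set.support_indicator_subset)
    exact ⟨_, this.hasSum.tendsto_sum_nat⟩
  · obtain ⟨y, hy⟩ := hx (Nat.nth (· ∈ s)) (Nat.nth_strictMono hs)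
    refine ⟨y, ?_⟩
    have hcount : Tendsto (Nat.count (· ∈ s)) atTop atTop :=
      tendsto_atTop_atTop_of_monotone (Nat.count_monotone _)
        fun k => ⟨Nat.nth (· ∈ s) k, (Nat.count_nth_of_infinite (p := (· ∈ s)) hs k).ge⟩
    refine (hy.comp hcount).congr fun n => ?_
    induction n with
    | zero => simp
    | succ n ih =>
      rw [Finset.sum_range_succ, ← ih]
      simp only [Function.comp_apply]
      rw [Nat.count_succ]
      split_ifs with hn
      · rw [Finset.sum_range_succ, Nat.nth_count (p := (· ∈ s)) hn, Set.indicator_of_mem hn]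
      · rw [Set.indicator_of_notMem hn, add_zero, add_zero]

theorem exists_finite_valued_approx (b : ℕ →ᵇ 𝕜) {ε : ℝ} (hε : 0 < ε) :
    ∃ (t : Finset 𝕜) (r : ℕ → 𝕜), (∀ i, r i ∈ t) ∧ ∀ i, ‖b i - r i‖ ≤ ε := by
  obtain ⟨t, ht, hcov⟩ := Metric.totallyBounded_iff.1
    (isCompact_closedBall (0 : 𝕜) ‖b‖).totallyBounded ε hε
  have h : ∀ i, ∃ v ∈ t, ‖b i - v‖ ≤ ε := by
    intro i
    have := hcov (show b i ∈ Metric.closedBall 0 ‖b‖ by simpa using b.norm_coe_le_norm i)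
    simp only [Set.mem_iUnion, Metric.mem_ball, dist_eq_norm] at this
    obtain ⟨v, hv, hbv⟩ := this
    exact ⟨v, hv, hbv.le⟩
  choose r hr hbr using h
  exact ⟨ht.toFinset, r, fun i => by simpa using hr i, hbr⟩

/-- A finitely valued `b` gives a finite combination of subseries. A general `b` is a uniform limit
of such sequences, with error controlled by the norm of `T`. -/
theorem IsUC.cauchySeq_trunc {T : C₀(ℕ, 𝕜) →L[𝕜] X} (hT : IsUC fun i => T (unitVec 𝕜 i))
    (b : ℕ →ᵇ 𝕜) : CauchySeq fun n => T (trunc n b) := by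
  classical
  have hfin : ∀ (t : Finset 𝕜) (r : ℕ → 𝕜), (∀ i, r i ∈ t) →
      CauchySeq fun n => T (trunc n r) := by
    intro t r hr
    choose y hy using fun v : 𝕜 => hT.exists_tendsto_indicator {i | r i = v}
    have h1 := tendsto_finsetSum t fun v _ => (hy v).const_smul v
    refine (h1.congr fun n => ?_).cauchySeq
    rw [map_trunc]
    simp only [Finset.smul_sum]
    rw [Finset.sum_comm]
    refine Finset.sum_congr rfl fun i _ => ?_
    rw [Finset.sum_eq_single (r i)]
    · simp
    · intro v _ hv
      rw [Set.indicator_of_notMem (by simpa using hv.symm), smul_zero]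
    · exact fun h => absurd (hr i) h
  rw [Metric.cauchySeq_iff']
  intro ε hε
  set δ : ℝ := ε / (4 * (‖T‖ + 1)) with hδ
  have hδ0 : 0 < δ := by positivity
  obtain ⟨t, r, hrt, hr⟩ := exists_finite_valued_approx b hδ0
  obtain ⟨N, hN⟩ := Metric.cauchySeq_iff'.1 (hfin t r hrt) _ (half_pos hε)
  have happ : ∀ n, ‖T (trunc n b) - T (trunc n r)‖ ≤ ε / 4 := by
    intro n
    rw [← map_sub]
    have h1 : ‖trunc n b - trunc n r‖ ≤ δ := (c0_norm_le hδ0.le).2 fun i => by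
      by_cases hi : i < n
      · simpa [trunc_apply, hi] using hr i
      · simpa [trunc_apply, hi] using hδ0.le
    refine (T.le_opNorm _).trans ?_
    calc ‖T‖ * ‖trunc n b - trunc n r‖ ≤ (‖T‖ + 1) * δ := by gcongr; linarith
      _ = ε / 4 := by rw [hδ]; field_simp
  refine ⟨N, fun n hn => ?_⟩
  have h1 := hN n hn
  rw [dist_eq_norm] at h1 ⊢
  have h2 : T (trunc n b) - T (trunc N b) = (T (trunc n b) - T (trunc n r)) +
    (T (trunc n r) - T (trunc N r)) - (T (trunc N b) - T (trunc N r)) := by abel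
  rw [h2]
  have h3 := norm_sub_le ((T (trunc n b) - T (trunc n r)) + (T (trunc n r) - T (trunc N r)))
    (T (trunc N b) - T (trunc N r))
  have h4 := norm_add_le (T (trunc n b) - T (trunc n r)) (T (trunc n r) - T (trunc N r))
  linarith [happ n, happ N]

theorem isHomogeneousPolynomial_clm (T : C₀(ℕ, 𝕜) →L[𝕜] X) :
    IsHomogeneousPolynomial 𝕜 1 T :=
  isHomogeneousPolynomial_id.comp T

theorem isUC_map_unitVec_iff [CompleteSpace X] (T : C₀(ℕ, 𝕜) →L[𝕜] X) :
    IsUC (fun i => T (unitVec 𝕜 i)) ↔ CoordCont T := by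
  classical
  constructor
  · intro h
    refine coordCont_of_weak_limits (isHomogeneousPolynomial_clm T) fun b => ?_
    obtain ⟨y, hy⟩ := cauchySeq_tendsto_of_complete (h.cauchySeq_trunc b)
    exact ⟨y, fun φ => (φ.continuous.tendsto y).comp hy⟩
  · intro h σ hσ
    have heq : ∀ n, ∑ i ∈ Finset.range n, unitVec 𝕜 (σ i) =
        ∑ m ∈ (Finset.range n).image σ, (1 : 𝕜) • unitVec 𝕜 m := fun n => by
      rw [Finset.sum_image fun _ _ _ _ h => hσ.injective h]
      simp
    have hval : ∀ n j, (∑ i ∈ Finset.range n, unitVec 𝕜 (σ i)) j =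
        if j ∈ (Finset.range n).image σ then 1 else 0 := fun n j => by
      rw [heq]
      exact sum_smul_unitVec_apply _ (fun _ => 1) j
    -- The partial sums of the unit vectors along `σ` lie in the unit ball and converge
    -- coordinatewise to the indicator of the range of `σ`.
    have := h.cauchy_map (l := atTop) (x := fun n => ∑ i ∈ Finset.range n, unitVec 𝕜 (σ i))
      (R := 1) (b := fun j => if j ∈ Set.range σ then 1 else 0)
      (Eventually.of_forall fun n => (c0_norm_le zero_le_one).2 fun j => by
        rw [hval]
        split_ifs <;> simp) (fun j => by
        refine tendsto_const_nhds.congr' ?_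
        by_cases hj : j ∈ Set.range σ
        · obtain ⟨i, rfl⟩ := hj
          filter_upwards [eventually_gt_atTop i] with n hn
          rw [hval, if_pos ⟨i, rfl⟩, if_pos]
          exact Finset.mem_image_of_mem _ (Finset.mem_range.2 hn)
        · refine Eventually.of_forall fun n => ?_
          beta_reduce
          rw [hval, if_neg hj, if_neg]
          intro hmem
          obtain ⟨i, -, rfl⟩ := Finset.mem_image.1 hmem
          exact hj ⟨i, rfl⟩)
    simpa only [map_sum] using cauchySeq_tendsto_of_complete this

/-! ### Both properties of `P` in terms of `CoordCont` -/

variable {Y : Type*} [NormedAddCommGroup Y] {k : ℕ} {P : X → Y}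

theorem isUnconditionallyConverging_of_coordCont [CompleteSpace X] [CompleteSpace Y]
    (h : ∀ T : C₀(ℕ, 𝕜) →L[𝕜] X, CoordCont fun a => P (T a)) :
    IsUnconditionallyConverging 𝕜 P := by
  intro x hx
  obtain ⟨T, hT⟩ := hx.exists_operator
  have := (h T).cauchy_map (l := atTop) (x := fun n => trunc n fun _ => 1) (R := 1)
    (Eventually.of_forall fun n => norm_trunc_le zero_le_one fun _ => by simp)
    (tendsto_trunc_apply _)
  simpa only [map_trunc, one_smul, hT] using cauchySeq_tendsto_of_complete this

theorem CoordCont.isRelCompact_image [CompleteSpace Y] {T : C₀(ℕ, 𝕜) →L[𝕜] X}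
    (h : CoordCont fun a => P (T a)) (R : ℝ) :
    IsRelCompact (P '' (T '' Metric.closedBall 0 R)) := by
  rw [Set.image_image]
  exact h.isRelCompact R

variable [NormedSpace 𝕜 Y]

theorem IsUnconditionallyConverging.coordCont (hP : IsHomogeneousPolynomial 𝕜 k P)
    (h : IsUnconditionallyConverging 𝕜 P) (T : C₀(ℕ, 𝕜) →L[𝕜] X) :
    CoordCont fun a => P (T a) := by
  refine coordCont_of_cauchySeq (hP.comp T).degLE ?_
  rintro w ⟨B, hB⟩
  obtain ⟨y, hy⟩ := h _ ((isWUC_of_sum_le hB).map T)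
  simpa only [map_sum] using hy.cauchySeq

theorem IsHomogeneousPolynomial.coordCont_of_image (hP : IsHomogeneousPolynomial 𝕜 k P)
    (T : C₀(ℕ, 𝕜) →L[𝕜] X)
    (h : IsRelWeaklyCompact 𝕜 (P '' (T '' Metric.closedBall 0 1))) :
    CoordCont fun a => P (T a) := by
  refine (hP.comp T).coordCont fun a ha => h.mono ?_
  rintro _ ⟨n, rfl⟩
  exact ⟨_, ⟨a n, by simpa using ha n, rfl⟩, rfl⟩

theorem coordCont_of_image_clm (T : C₀(ℕ, 𝕜) →L[𝕜] X)
    (h : IsRelWeaklyCompact 𝕜 (T '' Metric.closedBall 0 1)) : CoordCont T :=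
  isHomogeneousPolynomial_id.coordCont_of_image T (by rwa [Set.image_id])

theorem isOrliczPettis_iff [CompleteSpace X] [CompleteSpace Y]
    (hP : IsHomogeneousPolynomial 𝕜 k P) :
    IsOrliczPettis 𝕜 P ↔
      ∀ T : C₀(ℕ, 𝕜) →L[𝕜] X, (CoordCont fun a => P (T a)) → CoordCont T := by
  constructor
  · intro h T hT
    refine (isUC_map_unitVec_iff T).1 (h _ (isWUC_unitVec.map T) fun a ha => ?_)
    obtain ⟨R, hR⟩ := ha.exists_norm_le
    refine IsRelCompact.isRelWeaklyCompact ((hT.isRelCompact_image R).mono ?_)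
    rintro _ ⟨n, rfl⟩
    exact ⟨_, ⟨a n, by simpa using hR _ ⟨n, rfl⟩, rfl⟩,
      congrArg P (tsum_smul_map_unitVec T (a n)).symm⟩
  · intro h x hx hc
    obtain ⟨T, hT⟩ := hx.exists_operator
    obtain rfl : (fun i => T (unitVec 𝕜 i)) = x := funext hT
    refine (isUC_map_unitVec_iff T).2 (h T ((hP.comp T).coordCont fun a ha => ?_))
    have hb : Bornology.IsBounded (Set.range a) :=
      (Metric.isBounded_closedBall (x := (0 : C₀(ℕ, 𝕜))) (r := 1)).subset (by
        rintro _ ⟨n, rfl⟩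
        simpa using ha n)
    simpa only [tsum_smul_map_unitVec] using hc a hb

end

end OrliczPettis

theorem proposition2p3 {𝕜 : Type*} [RCLike 𝕜]
    {X : Type*} [NormedAddCommGroup X] [NormedSpace 𝕜 X] [CompleteSpace X]
    {Y : Type*} [NormedAddCommGroup Y] [NormedSpace 𝕜 Y] [CompleteSpace Y]
    (k : ℕ) (hk : 1 ≤ k) (P : X → Y) (hP : OrliczPettis.IsHomogeneousPolynomial 𝕜 k P) :
    ((OrliczPettis.IsUnconditionallyConverging 𝕜 P ↔
        ∀ A : Set X, OrliczPettis.IsWUCSet 𝕜 A → OrliczPettis.IsRelCompact (P '' A)) ∧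
      (OrliczPettis.IsUnconditionallyConverging 𝕜 P ↔
        ∀ A : Set X, OrliczPettis.IsWUCSet 𝕜 A → OrliczPettis.IsRelWeaklyCompact 𝕜 (P '' A))) ∧
    ((OrliczPettis.IsOrliczPettis 𝕜 P ↔
        ∀ A : Set X, OrliczPettis.IsWUCSet 𝕜 A →
          OrliczPettis.IsRelCompact (P '' A) → OrliczPettis.IsRelCompact A) ∧
      (OrliczPettis.IsOrliczPettis 𝕜 P ↔
        ∀ A : Set X, OrliczPettis.IsWUCSet 𝕜 A →
          OrliczPettis.IsRelWeaklyCompact 𝕜 (P '' A) → OrliczPettis.IsRelWeaklyCompact 𝕜 A)) := by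
  have hcc (T : C₀(ℕ, 𝕜) →L[𝕜] X)
      (h : OrliczPettis.IsRelCompact (P '' (T '' Metric.closedBall 0 1))) :
      OrliczPettis.CoordCont fun a => P (T a) :=
    hP.coordCont_of_image T h.isRelWeaklyCompact
  refine ⟨⟨⟨?_, fun h => ?_⟩, ⟨?_, fun h => ?_⟩⟩, ⟨?_, ?_⟩⟩
  · rintro h _ ⟨T, rfl⟩
    exact (h.coordCont hP T).isRelCompact_image 1
  · exact OrliczPettis.isUnconditionallyConverging_of_coordCont fun T => hcc T (h _ ⟨T, rfl⟩)
  · rintro h _ ⟨T, rfl⟩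
    exact ((h.coordCont hP T).isRelCompact_image 1).isRelWeaklyCompact
  · exact OrliczPettis.isUnconditionallyConverging_of_coordCont fun T =>
      hP.coordCont_of_image T (h _ ⟨T, rfl⟩)
  · rw [OrliczPettis.isOrliczPettis_iff hP]
    constructor
    · rintro h _ ⟨T, rfl⟩ hPT
      exact (h T (hcc T hPT)).isRelCompact 1
    · intro h T hT
      exact OrliczPettis.coordCont_of_image_clm T
        (h _ ⟨T, rfl⟩ (hT.isRelCompact_image 1)).isRelWeaklyCompact
  · rw [OrliczPettis.isOrliczPettis_iff hP]
    constructor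
    · rintro h _ ⟨T, rfl⟩ hPT
      exact ((h T (hP.coordCont_of_image T hPT)).isRelCompact 1).isRelWeaklyCompact
    · intro h T hT
      exact OrliczPettis.coordCont_of_image_clm T
        (h _ ⟨T, rfl⟩ (hT.isRelCompact_image 1).isRelWeaklyCompact)
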